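/- \textbf{Theorem.} Let $\mathbf B=(B,\wedge,\vee,\odot,\to,0,1)$ be a finite MTL-chain, i.e. a finite linearly ordered bounded integral commutative residuated lattice, and let $\mathcal V$ be a set of propositional variables. Let $\mathbf{MFm}$ be the set of multimodal formulas built from $\mathcal V$, truth constants $\overline b$ ($b\in B$), the binary connectives $\wedge,\vee,\odot,\to$ and unary modalities $\Box_b$ ($b\in B$). Write $\varphi\leftrightarrow\psi:=(\varphi\to\psi)\odot(\psi\to\varphi)$ and $\Diamond_b\varphi:=\bigwedge_{a\in B}\bigl(\Box_b(\varphi\to\overline a)\to\overline a\bigr)$. \emph{Semantics.} A $\mathbf B$-preference model is a triple $\mathfrak M=\langle W,P,e\rangle$ where $W$ is a set of worlds, $P\colon W\times W\to B$ satisfies $P(v,v)=1$ and $P(v,w)\wedge P(w,u)\le P(v,u)$ for all $v,w,u\in W$, and $e\colon W\times\mathcal V\to B$. The map $e$ is extended to formulas by the operations of $\mathbf B$, with $e(v,\overline b)=b$, and by $e(v,\Box_b\varphi)=\bigwedge\{e(w,\varphi): w\in W,\ P(v,w)\ge b\}$. For $\Gamma\cup\{\varphi\}\subseteq\mathbf{MFm}$,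 write $\Gamma\Vdash_{\mathbb P_{\mathbf B}}\varphi$ if for every $\mathbf B$-preference model and every world $v$ of it, $e(v,\gamma)=1$ for all $\gamma\in\Gamma$ implies $e(v,\varphi)=1$. \emph{The logic $\mathsf{mM}_{\mathbf B}$.} Its propositional axioms are, for all $\varphi,\psi,\chi\in\mathbf{MFm}$ and $a,b\in B$: $(\varphi\to\psi)\to((\psi\to\chi)\to(\varphi\to\chi))$; $(\varphi\to(\psi\to\chi))\to(\psi\to(\varphi\to\chi))$; $\varphi\to(\psi\to\varphi)$; $\varphi\to(\psi\to\varphi\odot\psi)$; $(\varphi\to(\psi\to\chi))\to(\varphi\odot\psi\to\chi)$; $\varphi\wedge\psi\to\varphi$; $\varphi\wedge\psi\to\psi$; $(\chi\to\varphi)\wedge(\chi\to\psi)\to(\chi\to\varphi\wedge\psi)$; $\varphi\to(\psi\to\varphi\wedge\psi)$; $\varphi\to\varphi\vee\psi$; $\psi\to\varphi\vee\psi$; $(\varphi\to\chi)\wedge(\psi\to\chi)\to(\varphi\vee\psi\to\chi)$; $(\varphi\to\psi)\vee(\psi\to\varphi)$; $\overline 0\to\varphi$; $\overline 1$; $\overline{a\star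 b}\leftrightarrow(\overline a\star\overline b)$ for $\star\in\{\wedge,\vee,\odot,\to\}$; $\bigvee_{a\in B}(\varphi\leftrightarrow\overline a)$. Its modal axioms are, for all $\varphi,\psi\in\mathbf{MFm}$ and $a,b,c\in B$, with $k$ the co-atom (immediate predecessor of $1$) of $\mathbf B$: \begin{itemize} \item (the system $\mathsf{CM}_{\mathbf B}$ for $\Box_c$) $\Box_c\overline 1$; $(\Box_c\varphi\wedge\Box_c\psi)\to\Box_c(\varphi\wedge\psi)$; $\Box_c(\overline b\to\varphi)\leftrightarrow(\overline b\to\Box_c\varphi)$; $\Box_c(\overline k\vee\varphi)\to\overline k\vee\Box_c\varphi$; \item (nestedness) $\Box_a\varphi\to\Box_b\varphi$ whenever $a\le b$; \item $T_a\colon\Box_a\varphi\to\varphi$; $4_{a,b}\colon\Box_{a\wedge b}\varphi\to\Box_a\Box_b\varphi$; $B_0\colon\varphi\to\Box_0\Diamond_0\varphi$. \end{itemize} Its propositional rules are modus ponens and ``from $\overline k\vee\varphi$ derive $\varphi$''. Its modal rules, for each $b\in B$, are ``from $\varphi\to\psi$ derive $\Box_b\varphi\to\Box_b\psi$'' and ``from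 $\varphi$ derive $\Box_b\varphi$''. The theorems of $\mathsf{mM}_{\mathbf B}$ form the least set of formulas containing all the axioms and closed under all the rules. Write $\Gamma\vdash_{\mathsf{mM}_{\mathbf B}}\varphi$ if $\varphi$ is obtained from theorems and elements of $\Gamma$ by the propositional rules (so the modal rules apply to theorems only). If $B$ has a single element there is no co-atom, and the axiom and the rule that mention $k$ are absent. Then, for every set $\Gamma\subseteq\mathbf{MFm}$, finite or infinite, and every $\varphi\in\mathbf{MFm}$, \[\Gamma\vdash_{\mathsf{mM}_{\mathbf B}}\varphi\quad\Longleftrightarrow\quad\Gamma\Vdash_{\mathbb P_{\mathbf B}}\varphi.\] -/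

import Mathlib

universe u v w

/-- An MTL-chain: a linearly ordered bounded integral commutative residuated lattice
`(B, ∧, ∨, ⊙, →, 0, 1)`. Here `∧` and `∨` are `min` and `max`, `⊙` is the monoid product `*`,
the constant `0` is `⊥`, and the monoid unit `1` is the top element `⊤` (integrality).
The last field is the residuation law. -/
class MTLChain (B : Type*) extends LinearOrder B, BoundedOrder B, CommMonoid B where
  imp : B → B → B
  one_eq_top : (1 : B) = ⊤
  mul_le_iff_le_imp : ∀ a b c : B, a * b ≤ c ↔ a ≤ imp b c

namespace FuzzyPref

/-- Multi-modal formulas over the truth values `B` and the propositional variables `V`: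
variables, truth constants, the four residuated lattice connectives, and `□_b` for `b : B`. -/
inductive Fm (B : Type*) (V : Type*) where
  | var : V → Fm B V
  | const : B → Fm B V
  | and : Fm B V → Fm B V → Fm B V
  | or : Fm B V → Fm B V → Fm B V
  | prod : Fm B V → Fm B V → Fm B V
  | imp : Fm B V → Fm B V → Fm B V
  | box : B → Fm B V → Fm B V

namespace Fm

/-- `φ ↔ ψ` abbreviates `(φ → ψ) ⊙ (ψ → φ)`. -/
def iff {B V : Type*} (φ ψ : Fm B V) : Fm B V := prod (imp φ ψ) (imp ψ φ)

/-- The finite conjunction `⋀_{a ∈ B} f a`, listed in the order of `B`. -/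
def bigAnd {B V : Type*} [MTLChain B] [Fintype B] (f : B → Fm B V) : Fm B V :=
  ((Finset.univ : Finset B).sort (· ≤ ·)).foldr (fun a ψ => and (f a) ψ) (const 1)

/-- The finite disjunction `⋁_{a ∈ B} f a`, listed in the order of `B`. -/
def bigOr {B V : Type*} [MTLChain B] [Fintype B] (f : B → Fm B V) : Fm B V :=
  ((Finset.univ : Finset B).sort (· ≤ ·)).foldr (fun a ψ => or (f a) ψ) (const ⊥)

/-- `◇_b φ` abbreviates `⋀_{a ∈ B} (□_b (φ → a) → a)`. -/
def dia {B V : Type*} [MTLChain B] [Fintype B] (b : B) (φ : Fm B V) : Fm B V :=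
  bigAnd fun a => imp (box b (imp φ (const a))) (const a)

end Fm

open Fm

/-- The axioms of the propositional logic `Λ(B^c)` of `B` with canonical truth constants:
the axioms of MTL, the bookkeeping axioms, and the axiom saying that every formula takes
one of the values in `B`. -/
inductive PropAxiom {B V : Type*} [MTLChain B] [Fintype B] : Fm B V → Prop where
  | suffixing (φ ψ χ : Fm B V) :
      PropAxiom (imp (imp φ ψ) (imp (imp ψ χ) (imp φ χ)))
  | exchange (φ ψ χ : Fm B V) :
      PropAxiom (imp (imp φ (imp ψ χ)) (imp ψ (imp φ χ)))
  | weakening (φ ψ : Fm B V) : PropAxiom (imp φ (imp ψ φ))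
  | prodIntro (φ ψ : Fm B V) : PropAxiom (imp φ (imp ψ (prod φ ψ)))
  | prodElim (φ ψ χ : Fm B V) :
      PropAxiom (imp (imp φ (imp ψ χ)) (imp (prod φ ψ) χ))
  | andLeft (φ ψ : Fm B V) : PropAxiom (imp (and φ ψ) φ)
  | andRight (φ ψ : Fm B V) : PropAxiom (imp (and φ ψ) ψ)
  | andIntro (φ ψ χ : Fm B V) :
      PropAxiom (imp (and (imp χ φ) (imp χ ψ)) (imp χ (and φ ψ)))
  | adjunction (φ ψ : Fm B V) : PropAxiom (imp φ (imp ψ (and φ ψ)))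
  | orLeft (φ ψ : Fm B V) : PropAxiom (imp φ (or φ ψ))
  | orRight (φ ψ : Fm B V) : PropAxiom (imp ψ (or φ ψ))
  | orElim (φ ψ χ : Fm B V) :
      PropAxiom (imp (and (imp φ χ) (imp ψ χ)) (imp (or φ ψ) χ))
  | prelinearity (φ ψ : Fm B V) : PropAxiom (or (imp φ ψ) (imp ψ φ))
  | exFalso (φ : Fm B V) : PropAxiom (imp (const ⊥) φ)
  | truth : PropAxiom (const 1)
  | bookAnd (a b : B) :
      PropAxiom (Fm.iff (const (min a b)) (and (const a) (const b)))
  | bookOr (a b : B) :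
      PropAxiom (Fm.iff (const (max a b)) (or (const a) (const b)))
  | bookProd (a b : B) :
      PropAxiom (Fm.iff (const (a * b)) (prod (const a) (const b)))
  | bookImp (a b : B) :
      PropAxiom (Fm.iff (const (MTLChain.imp a b)) (imp (const a) (const b)))
  | witness (φ : Fm B V) : PropAxiom (bigOr fun a => Fm.iff φ (const a))

/-- The modal axioms of `mM_B`. The first four are those of `CM_B` for each `□_c`, where in
`crisp` the element `k` is the co-atom of `B`, the immediate predecessor of `1`. -/
inductive ModalAxiom {B V : Type*} [MTLChain B] [Fintype B] : Fm B V → Prop where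
  | boxOne (c : B) : ModalAxiom (box c (const 1))
  | boxAnd (c : B) (φ ψ : Fm B V) :
      ModalAxiom (imp (and (box c φ) (box c ψ)) (box c (and φ ψ)))
  | boxConst (c b : B) (φ : Fm B V) :
      ModalAxiom (Fm.iff (box c (imp (const b) φ)) (imp (const b) (box c φ)))
  | crisp (c k : B) (hk : IsCoatom k) (φ : Fm B V) :
      ModalAxiom (imp (box c (or (const k) φ)) (or (const k) (box c φ)))
  | nested (a b : B) (hab : a ≤ b) (φ : Fm B V) : ModalAxiom (imp (box a φ) (box b φ))
  | reflexive (a : B) (φ : Fm B V) : ModalAxiom (imp (box a φ) φ)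
  | transitive (a b : B) (φ : Fm B V) :
      ModalAxiom (imp (box (min a b) φ) (box a (box b φ)))
  | symmetric (φ : Fm B V) : ModalAxiom (imp φ (box ⊥ (dia ⊥ φ)))

/-- The theorems of `mM_B`: the least set of formulas that contains the axioms and is closed
under the propositional rules (modus ponens, and from `k ∨ φ` derive `φ`, for `k` the co-atom)
and the modal rules (monotonicity and necessitation, for every `□_b`). -/
inductive IsTheorem {B V : Type*} [MTLChain B] [Fintype B] : Fm B V → Prop where
  | propAxiom {φ : Fm B V} : PropAxiom φ → IsTheorem φ
  | modalAxiom {φ : Fm B V} : ModalAxiom φ → IsTheorem φ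
  | mp {φ ψ : Fm B V} : IsTheorem φ → IsTheorem (imp φ ψ) → IsTheorem ψ
  | coatom {k : B} {φ : Fm B V} :
      IsCoatom k → IsTheorem (or (const k) φ) → IsTheorem φ
  | mon (b : B) {φ ψ : Fm B V} :
      IsTheorem (imp φ ψ) → IsTheorem (imp (box b φ) (box b ψ))
  | nec (b : B) {φ : Fm B V} : IsTheorem φ → IsTheorem (box b φ)

/-- `Γ ⊢ φ` in `mM_B`: derivability from the theorems and the premises in `Γ` by means of the
propositional rules. The modal rules act on theorems only, as the consequence is local. -/
inductive Derives {B V : Type*} [MTLChain B] [Fintype B] (Γ : Set (Fm B V)) :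
    Fm B V → Prop where
  | thm {φ : Fm B V} : IsTheorem φ → Derives Γ φ
  | premise {φ : Fm B V} : φ ∈ Γ → Derives Γ φ
  | mp {φ ψ : Fm B V} : Derives Γ φ → Derives Γ (imp φ ψ) → Derives Γ ψ
  | coatom {k : B} {φ : Fm B V} :
      IsCoatom k → Derives Γ (or (const k) φ) → Derives Γ φ

/-- A `B`-preference model: a set of worlds, a reflexive and `∧`-transitive `B`-valued
relation `P` on it, and an evaluation `e` of the variables at each world. -/
structure PrefModel (B : Type u) (V : Type v) [MTLChain B] where
  W : Type w
  P : W → W → B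
  e : W → V → B
  refl : ∀ x, P x x = 1
  trans : ∀ x y z, min (P x y) (P y z) ≤ P x z

open Classical in
/-- The meet in the finite chain `B` of an arbitrary set of truth values. -/
noncomputable def meet {B : Type u} [MTLChain B] [Fintype B] (S : Set B) : B :=
  (Finset.univ.filter (· ∈ S)).inf id

theorem isGLB_meet {B : Type u} [MTLChain B] [Fintype B] (S : Set B) : IsGLB S (meet S) := by
  classical
  constructor
  · intro x hx
    exact Finset.inf_le (f := id) (by simpa using hx)
  · intro y hy
    exact Finset.le_inf fun x hx => hy (by simpa using hx)

/-- The value of a formula at a world; `□_b φ` takes the meet of the values of `φ` over the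
worlds `y` with `P x y ≥ b`. -/
noncomputable def PrefModel.eval {B : Type u} {V : Type v} [MTLChain B] [Fintype B]
    (M : PrefModel.{u, v, w} B V) : Fm B V → M.W → B
  | .var p, x => M.e x p
  | .const a, _ => a
  | .and φ ψ, x => min (M.eval φ x) (M.eval ψ x)
  | .or φ ψ, x => max (M.eval φ x) (M.eval ψ x)
  | .prod φ ψ, x => M.eval φ x * M.eval ψ x
  | .imp φ ψ, x => MTLChain.imp (M.eval φ x) (M.eval ψ x)
  | .box b φ, x => meet {a : B | ∃ y : M.W, b ≤ M.P x y ∧ M.eval φ y = a}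

/-- Local consequence in one model. -/
def PrefModel.Entails {B : Type u} {V : Type v} [MTLChain B] [Fintype B]
    (M : PrefModel.{u, v, w} B V) (Γ : Set (Fm B V)) (φ : Fm B V) : Prop :=
  ∀ x : M.W, (∀ γ ∈ Γ, M.eval γ x = 1) → M.eval φ x = 1

/-- Local consequence over all `B`-preference models. -/
def PrefEntails {B : Type u} {V : Type v} [MTLChain B] [Fintype B]
    (Γ : Set (Fm B V)) (φ : Fm B V) : Prop :=
  ∀ M : PrefModel.{u, v, w} B V, M.Entails Γ φ

end FuzzyPref

/-! Soundness is an induction on derivations. Completeness uses a canonical model whose worlds are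
the valuations `Fm B V → B` giving every theorem the value 1. Worlds come from Zorn's lemma: a set
`T` maximal among those not deriving `φ` is prime, because the propositional rules survive under a
side disjunct. With the axiom `⋁ (ψ ↔ a)`, primality makes every `ψ` equivalent over `T` to a
constant, unique because constants other than 1 are inconsistent (`exists_world_of_not_derives`). No
compactness is needed, as derivations are finite. Put `Acc b g g'` when `g(□_b φ) ≤ g'(φ)` for all
`φ`. The formulas whose `□_b` has value 1 at `g` are closed under derivation, the co-atom axiom
standing in for axiom K; so `g(□_b φ)` is the meet of `φ` over the `Acc b`-successors
(`World.le_val_box`). The axioms make `Acc` reflexive, antitone in `b` and transitive up to `min`,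
and make `Acc ⊥` an equivalence. On a single `Acc ⊥`-class, `P g g' = max {b | Acc b g g'}` recovers
all the relations at once, and evaluation in that class agrees with the worlds. -/

namespace MTLChain

/-! ### Arithmetic of MTL-chains -/

variable {B : Type*} [MTLChain B] {a b c d : B}

theorem le_one (a : B) : a ≤ 1 := one_eq_top (B := B) ▸ le_top

theorem one_le_iff : 1 ≤ a ↔ a = 1 :=
  ⟨fun h => le_antisymm (le_one a) h, fun h => h.ge⟩

theorem le_imp_iff : a ≤ imp b c ↔ a * b ≤ c := (mul_le_iff_le_imp a b c).symm

theorem imp_eq_one_iff : imp a b = 1 ↔ a ≤ b := by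
  rw [← one_le_iff, le_imp_iff, one_mul]

theorem imp_mul_le (a b : B) : imp a b * a ≤ b := le_imp_iff.1 le_rfl

theorem mul_le_mul_chain (h : a ≤ b) (h' : c ≤ d) : a * c ≤ b * d := by
  have h1 : a * c ≤ b * c := le_imp_iff.1 (h.trans (le_imp_iff.2 le_rfl))
  have h2 : c * b ≤ d * b := le_imp_iff.1 (h'.trans (le_imp_iff.2 le_rfl))
  rw [mul_comm c, mul_comm d] at h2
  exact h1.trans h2

theorem mul_le_left (a b : B) : a * b ≤ a := by
  simpa using mul_le_mul_chain (le_refl a) (le_one b)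

theorem mul_le_right (a b : B) : a * b ≤ b := by
  simpa using mul_le_mul_chain (le_one a) (le_refl b)

theorem one_imp (a : B) : imp 1 a = a :=
  le_antisymm (by simpa using imp_mul_le 1 a) (le_imp_iff.2 (mul_le_left a 1))

theorem biimp_eq_one_iff : imp a b * imp b a = 1 ↔ a = b := by
  constructor
  · intro h
    apply le_antisymm <;> rw [← imp_eq_one_iff, ← one_le_iff, ← h]
    exacts [mul_le_left _ _, mul_le_right _ _]
  · rintro rfl
    rw [imp_eq_one_iff.2 le_rfl, one_mul]

theorem le_coatom {k : B} (hk : IsCoatom k) (ha : a ≠ 1) : a ≤ k := by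
  by_contra h
  exact ha ((hk.2 a (lt_of_not_ge h)).trans one_eq_top.symm)

theorem coatom_ne_one {k : B} (hk : IsCoatom k) : k ≠ 1 :=
  fun h => hk.1 (h.trans one_eq_top)

/-- In a chain every value other than 1 is at most `k`. This is the soundness of the co-atom rule.
-/
theorem max_coatom_eq_one_iff {k : B} (hk : IsCoatom k) : max k a = 1 ↔ a = 1 := by
  constructor
  · intro h
    by_contra ha
    exact coatom_ne_one hk ((max_eq_left (le_coatom hk ha)).symm.trans h)
  · rintro rfl
    exact max_eq_right (le_one k)

end MTLChain

namespace FuzzyPref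

open Fm MTLChain

/-! ### Valuations and the propositional axioms -/

section Valuation

variable {B : Type*} {V : Type*} [MTLChain B]

/-- A map from formulas to truth values that respects constants and connectives. -/
structure IsValuation (v : Fm B V → B) : Prop where
  const : ∀ a, v (const a) = a
  and : ∀ φ ψ, v (and φ ψ) = min (v φ) (v ψ)
  or : ∀ φ ψ, v (or φ ψ) = max (v φ) (v ψ)
  prod : ∀ φ ψ, v (prod φ ψ) = v φ * v ψ
  imp : ∀ φ ψ, v (imp φ ψ) = MTLChain.imp (v φ) (v ψ)

namespace IsValuation

variable {v : Fm B V → B} (hv : IsValuation v)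
include hv

theorem iff (φ ψ : Fm B V) :
    v (Fm.iff φ ψ) = MTLChain.imp (v φ) (v ψ) * MTLChain.imp (v ψ) (v φ) := by
  rw [Fm.iff, hv.prod, hv.imp, hv.imp]

theorem imp_eq_one {φ ψ : Fm B V} : v (Fm.imp φ ψ) = 1 ↔ v φ ≤ v ψ := by
  rw [hv.imp, imp_eq_one_iff]

theorem iff_eq_one {φ ψ : Fm B V} : v (Fm.iff φ ψ) = 1 ↔ v φ = v ψ := by
  rw [hv.iff, biimp_eq_one_iff]

variable [Fintype B]

theorem le_bigAnd {f : B → Fm B V} {c : B} : c ≤ v (bigAnd f) ↔ ∀ a, c ≤ v (f a) := by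
  have key : ∀ l : List B,
      c ≤ v (l.foldr (fun a ψ => Fm.and (f a) ψ) (.const 1)) ↔ ∀ a ∈ l, c ≤ v (f a) := by
    intro l
    induction l with
    | nil => simp [hv.const, le_one]
    | cons a l ih => simp [hv.and, ih]
  simpa [bigAnd] using key (Finset.univ.sort (· ≤ ·))

theorem le_bigOr (f : B → Fm B V) (a : B) : v (f a) ≤ v (bigOr f) := by
  have key : ∀ l : List B, a ∈ l →
      v (f a) ≤ v (l.foldr (fun a ψ => Fm.or (f a) ψ) (.const ⊥)) := by
    intro l hl
    induction l with
    | nil => simp at hl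
    | cons b l ih =>
      rw [List.foldr_cons, hv.or]
      rcases List.mem_cons.1 hl with rfl | hl
      · exact le_max_left _ _
      · exact (ih hl).trans (le_max_right _ _)
  exact key _ (by simp)

theorem propAxiom {φ : Fm B V} (h : PropAxiom φ) : v φ = 1 := by
  cases h with
  | suffixing φ ψ χ =>
    rw [hv.imp_eq_one]
    simp only [hv.imp, le_imp_iff]
    calc MTLChain.imp (v φ) (v ψ) * MTLChain.imp (v ψ) (v χ) * v φ
        = MTLChain.imp (v ψ) (v χ) * (MTLChain.imp (v φ) (v ψ) * v φ) := by ac_rfl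
      _ ≤ MTLChain.imp (v ψ) (v χ) * v ψ := mul_le_mul_chain le_rfl (imp_mul_le _ _)
      _ ≤ v χ := imp_mul_le _ _
  | exchange φ ψ χ =>
    rw [hv.imp_eq_one]
    simp only [hv.imp, le_imp_iff]
    rw [mul_right_comm, ← le_imp_iff]
    exact imp_mul_le _ _
  | weakening φ ψ =>
    rw [hv.imp_eq_one, hv.imp, le_imp_iff]
    exact mul_le_left _ _
  | prodIntro φ ψ =>
    rw [hv.imp_eq_one]
    simp only [hv.imp, hv.prod, le_imp_iff, le_refl]
  | prodElim φ ψ χ =>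
    rw [hv.imp_eq_one]
    simp only [hv.imp, hv.prod, le_imp_iff]
    rw [← mul_assoc, ← le_imp_iff]
    exact imp_mul_le _ _
  | andLeft φ ψ => simp [hv.imp_eq_one, hv.and]
  | andRight φ ψ => simp [hv.imp_eq_one, hv.and]
  | andIntro φ ψ χ =>
    rw [hv.imp_eq_one]
    simp only [hv.imp, hv.and, le_imp_iff, le_min_iff]
    exact ⟨le_imp_iff.1 (min_le_left _ _), le_imp_iff.1 (min_le_right _ _)⟩
  | adjunction φ ψ =>
    rw [hv.imp_eq_one]
    simp only [hv.imp, hv.and, le_imp_iff, le_min_iff]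
    exact ⟨mul_le_left _ _, mul_le_right _ _⟩
  | orLeft φ ψ => simp [hv.imp_eq_one, hv.or]
  | orRight φ ψ => simp [hv.imp_eq_one, hv.or]
  | orElim φ ψ χ =>
    rw [hv.imp_eq_one]
    simp only [hv.imp, hv.or, hv.and]
    rcases le_total (v φ) (v ψ) with h | h
    · rw [max_eq_right h]; exact min_le_right _ _
    · rw [max_eq_left h]; exact min_le_left _ _
  | prelinearity φ ψ =>
    rw [hv.or, ← one_le_iff, le_max_iff, one_le_iff, one_le_iff, hv.imp_eq_one, hv.imp_eq_one]
    exact le_total _ _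
  | exFalso φ => simp [hv.imp_eq_one, hv.const]
  | truth => exact hv.const 1
  | bookAnd a b => simp [hv.iff_eq_one, hv.and, hv.const]
  | bookOr a b => simp [hv.iff_eq_one, hv.or, hv.const]
  | bookProd a b => simp [hv.iff_eq_one, hv.prod, hv.const]
  | bookImp a b => simp [hv.iff_eq_one, hv.imp, hv.const]
  | witness φ =>
    -- The disjunct indexed by the actual value `v φ` already has value 1.
    rw [← one_le_iff, ← hv.iff_eq_one.2 (hv.const (v φ)).symm]
    exact hv.le_bigOr (fun a => Fm.iff φ (Fm.const a)) (v φ)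

end IsValuation

end Valuation

/-! ### Soundness -/

section Soundness

theorem le_meet_iff {B : Type*} [MTLChain B] [Fintype B] {S : Set B} {c : B} :
    c ≤ meet S ↔ ∀ a ∈ S, c ≤ a :=
  le_isGLB_iff (isGLB_meet S)

variable {B : Type u} {V : Type v} [MTLChain B] [Fintype B] (M : PrefModel.{u, v, w} B V)

theorem PrefModel.isValuation_eval (x : M.W) : IsValuation (fun φ => M.eval φ x) where
  const _ := by simp only [PrefModel.eval]
  and _ _ := by simp only [PrefModel.eval]
  or _ _ := by simp only [PrefModel.eval]
  prod _ _ := by simp only [PrefModel.eval]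
  imp _ _ := by simp only [PrefModel.eval]

variable {M}

theorem PrefModel.le_eval_box {b c : B} {φ : Fm B V} {x : M.W} :
    c ≤ M.eval (box b φ) x ↔ ∀ y, b ≤ M.P x y → c ≤ M.eval φ y := by
  rw [PrefModel.eval, le_meet_iff]
  constructor
  · exact fun h y hy => h _ ⟨y, hy, rfl⟩
  · rintro h _ ⟨y, hy, rfl⟩
    exact h y hy

theorem PrefModel.eval_box_le {b : B} (φ : Fm B V) {x y : M.W} (h : b ≤ M.P x y) :
    M.eval (box b φ) x ≤ M.eval φ y :=
  PrefModel.le_eval_box.1 le_rfl y h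

theorem PrefModel.eval_modalAxiom {φ : Fm B V} (h : ModalAxiom φ) (x : M.W) :
    M.eval φ x = 1 := by
  have hv := M.isValuation_eval
  have imp_one : ∀ {φ ψ : Fm B V}, M.eval φ x ≤ M.eval ψ x → M.eval (imp φ ψ) x = 1 :=
    fun h => (hv x).imp_eq_one.2 h
  cases h with
  | boxOne c =>
    rw [← one_le_iff, PrefModel.le_eval_box]
    exact fun y _ => ((hv y).const 1).ge
  | boxAnd c φ ψ =>
    refine imp_one (PrefModel.le_eval_box.2 fun y hy => ?_)
    rw [(hv x).and, (hv y).and]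
    exact min_le_min (eval_box_le _ hy) (eval_box_le _ hy)
  | boxConst c b φ =>
    refine (hv x).iff_eq_one.2 (le_antisymm ?_ (PrefModel.le_eval_box.2 fun y hy => ?_))
    · rw [(hv x).imp, (hv x).const, le_imp_iff, PrefModel.le_eval_box]
      intro y hy
      rw [← le_imp_iff]
      have := eval_box_le (imp (const b) φ) hy
      rwa [(hv y).imp, (hv y).const] at this
    · rw [(hv x).imp, (hv x).const, (hv y).imp, (hv y).const, le_imp_iff]
      exact (imp_mul_le _ _).trans (eval_box_le _ hy)
  | crisp c k hk φ =>
    refine imp_one ?_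
    rw [(hv x).or, (hv x).const]
    -- If the boxed value exceeds `k`, then at each successor the maximum bounding it must come from
    -- `φ`.
    rcases le_or_gt (M.eval (box c (or (const k) φ)) x) k with h | h
    · exact h.trans (le_max_left _ _)
    · refine le_trans (PrefModel.le_eval_box.2 fun y hy => ?_) (le_max_right _ _)
      have h1 := eval_box_le (or (const k) φ) hy
      rw [(hv y).or, (hv y).const, le_max_iff] at h1
      exact h1.resolve_left h.not_ge
  | nested a b hab φ =>
    exact imp_one (PrefModel.le_eval_box.2 fun y hy => eval_box_le _ (hab.trans hy))
  | reflexive a φ => exact imp_one (eval_box_le _ ((le_one a).trans (M.refl x).ge))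
  | transitive a b φ =>
    exact imp_one (PrefModel.le_eval_box.2 fun y hy => PrefModel.le_eval_box.2 fun z hz =>
      eval_box_le _ ((min_le_min hy hz).trans (M.trans x y z)))
  | symmetric φ =>
    refine imp_one (PrefModel.le_eval_box.2 fun y _ => ?_)
    rw [dia, (hv y).le_bigAnd]
    intro a
    rw [(hv y).imp, (hv y).const, le_imp_iff, mul_comm, ← le_imp_iff]
    have := eval_box_le (imp φ (const a)) (bot_le : ⊥ ≤ M.P y x)
    rwa [(hv x).imp, (hv x).const] at this

theorem PrefModel.eval_isTheorem {φ : Fm B V} (h : IsTheorem φ) : ∀ x : M.W, M.eval φ x = 1 := by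
  have hv := M.isValuation_eval
  induction h with
  | propAxiom h => exact fun x => (hv x).propAxiom h
  | modalAxiom h => exact PrefModel.eval_modalAxiom h
  | mp _ _ ih ih' =>
    exact fun x => one_le_iff.1 ((ih x).ge.trans ((hv x).imp_eq_one.1 (ih' x)))
  | coatom hk _ ih =>
    intro x
    have := ih x
    rwa [(hv x).or, (hv x).const, max_coatom_eq_one_iff hk] at this
  | mon b _ ih =>
    exact fun x => (hv x).imp_eq_one.2 (PrefModel.le_eval_box.2 fun y hy =>
      (eval_box_le _ hy).trans ((hv y).imp_eq_one.1 (ih y)))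
  | nec b _ ih =>
    exact fun x => one_le_iff.1 (PrefModel.le_eval_box.2 fun y _ => (ih y).ge)

theorem Derives.sound {Γ : Set (Fm B V)} {φ : Fm B V} (h : Derives Γ φ) : M.Entails Γ φ := by
  intro x hx
  have hv := M.isValuation_eval x
  induction h with
  | thm h => exact PrefModel.eval_isTheorem h x
  | premise h => exact hx _ h
  | mp _ _ ih ih' => exact one_le_iff.1 (ih.ge.trans (hv.imp_eq_one.1 ih'))
  | coatom hk _ ih => rwa [hv.or, hv.const, max_coatom_eq_one_iff hk] at ih

end Soundness

/-! ### Derived rules of the calculus -/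

section Calculus

variable {B : Type*} {V : Type*} [MTLChain B] [Fintype B] {Γ : Set (Fm B V)}
  {φ φ' ψ ψ' χ δ : Fm B V}

namespace Derives

theorem ax (h : PropAxiom φ) : Derives Γ φ := .thm (.propAxiom h)

theorem mono {Δ : Set (Fm B V)} (hΓ : Γ ⊆ Δ) (h : Derives Γ φ) : Derives Δ φ := by
  induction h with
  | thm h => exact .thm h
  | premise h => exact .premise (hΓ h)
  | mp _ _ ih ih' => exact .mp ih ih'
  | coatom hk _ ih => exact .coatom hk ih

theorem isTheorem (h : Derives (∅ : Set (Fm B V)) φ) : IsTheorem φ := by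
  induction h with
  | thm h => exact h
  | premise h => exact h.elim
  | mp _ _ ih ih' => exact .mp ih ih'
  | coatom hk _ ih => exact .coatom hk ih

theorem imp_const (h : Derives Γ φ) (ψ : Fm B V) : Derives Γ (imp ψ φ) :=
  .mp h (ax (.weakening _ _))

theorem swap (h : Derives Γ (imp φ (imp ψ χ))) : Derives Γ (imp ψ (imp φ χ)) :=
  .mp h (ax (.exchange _ _ _))

theorem imp_refl (φ : Fm B V) : Derives Γ (imp φ φ) :=
  .mp (ax .truth) (swap (ax (.weakening φ (const 1))))

theorem imp_trans (h : Derives Γ (imp φ ψ)) (h' : Derives Γ (imp ψ χ)) : Derives Γ (imp φ χ) :=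
  .mp h' (.mp h (ax (.suffixing _ _ _)))

theorem imp_mono (h : Derives Γ (imp φ' φ)) (h' : Derives Γ (imp ψ ψ')) :
    Derives Γ (imp (imp φ ψ) (imp φ' ψ')) :=
  imp_trans (.mp h (ax (.suffixing _ _ _))) (.mp h' (swap (ax (.suffixing _ _ _))))

theorem prod_mono (h : Derives Γ (imp φ φ')) (h' : Derives Γ (imp ψ ψ')) :
    Derives Γ (imp (prod φ ψ) (prod φ' ψ')) :=
  .mp (imp_trans h (imp_trans (ax (.prodIntro φ' ψ')) (imp_mono h' (imp_refl _))))
    (ax (.prodElim _ _ _))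

theorem and_intro (h : Derives Γ φ) (h' : Derives Γ ψ) : Derives Γ (and φ ψ) :=
  .mp h' (.mp h (ax (.adjunction _ _)))

theorem imp_and (h : Derives Γ (imp χ φ)) (h' : Derives Γ (imp χ ψ)) :
    Derives Γ (imp χ (and φ ψ)) :=
  .mp (and_intro h h') (ax (.andIntro _ _ _))

theorem and_mono (h : Derives Γ (imp φ φ')) (h' : Derives Γ (imp ψ ψ')) :
    Derives Γ (imp (and φ ψ) (and φ' ψ')) :=
  imp_and (imp_trans (ax (.andLeft _ _)) h) (imp_trans (ax (.andRight _ _)) h')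

theorem or_imp (h : Derives Γ (imp φ χ)) (h' : Derives Γ (imp ψ χ)) :
    Derives Γ (imp (or φ ψ) χ) :=
  .mp (and_intro h h') (ax (.orElim _ _ _))

theorem or_mono (h : Derives Γ (imp φ φ')) (h' : Derives Γ (imp ψ ψ')) :
    Derives Γ (imp (or φ ψ) (or φ' ψ')) :=
  or_imp (imp_trans h (ax (.orLeft _ _))) (imp_trans h' (ax (.orRight _ _)))

theorem or_inl (h : Derives Γ φ) (ψ : Fm B V) : Derives Γ (or φ ψ) := .mp h (ax (.orLeft _ _))

theorem iff_intro (h : Derives Γ (imp φ ψ)) (h' : Derives Γ (imp ψ φ)) :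
    Derives Γ (Fm.iff φ ψ) :=
  .mp h' (.mp h (ax (.prodIntro _ _)))

theorem iff_mp (h : Derives Γ (Fm.iff φ ψ)) : Derives Γ (imp φ ψ) :=
  .mp h (.mp (ax (.weakening _ _)) (ax (.prodElim _ _ _)))

theorem iff_mpr (h : Derives Γ (Fm.iff φ ψ)) : Derives Γ (imp ψ φ) :=
  .mp h (.mp (imp_const (imp_refl _) _) (ax (.prodElim _ _ _)))

theorem iff_symm (h : Derives Γ (Fm.iff φ ψ)) : Derives Γ (Fm.iff ψ φ) :=
  iff_intro h.iff_mpr h.iff_mp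

theorem iff_trans (h : Derives Γ (Fm.iff φ ψ)) (h' : Derives Γ (Fm.iff ψ χ)) :
    Derives Γ (Fm.iff φ χ) :=
  iff_intro (imp_trans h.iff_mp h'.iff_mp) (imp_trans h'.iff_mpr h.iff_mpr)

/-- The propositional rules stay derivable under a disjunction with a side formula. -/
theorem or_of_forall {Δ : Set (Fm B V)} (h : Derives Γ φ)
    (hΔ : ∀ γ ∈ Γ, Derives Δ (or γ δ)) : Derives Δ (or φ δ) := by
  induction h with
  | thm h => exact or_inl (.thm h) _
  | premise h => exact hΔ _ h
  | @mp φ ψ _ _ ih ih' =>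
    -- Both `φ → ψ` and `δ` imply `φ → ψ ∨ δ`, the latter by weakening.
    have h1 : Derives Δ (imp φ (or ψ δ)) :=
      .mp ih' (or_imp (imp_mono (imp_refl _) (ax (.orLeft _ _)))
        (imp_trans (ax (.orRight ψ δ)) (ax (.weakening _ _))))
    exact .mp ih (or_imp h1 (ax (.orRight _ _)))
  | @coatom k φ hk _ ih =>
    exact .coatom hk (.mp ih (or_imp (or_mono (imp_refl _) (ax (.orLeft _ _)))
      (imp_trans (ax (.orRight φ δ)) (ax (.orRight _ _)))))

/-- A deduction theorem need not hold here, so the disjuncts are eliminated in turn: run the first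
derivation beside `ψ` to get `χ ∨ ψ`, then the second beside `χ` to get `χ ∨ χ`. -/
theorem or_elim (h : Derives Γ (or φ ψ)) (h1 : Derives (insert φ Γ) χ)
    (h2 : Derives (insert ψ Γ) χ) : Derives Γ χ := by
  have h3 : Derives Γ (or χ ψ) := h1.or_of_forall fun γ hγ => by
    rcases hγ with rfl | hγ
    · exact h
    · exact or_inl (.premise hγ) _
  have h4 : Derives Γ (or χ χ) := h2.or_of_forall fun γ hγ => by
    rcases hγ with rfl | hγ
    · exact .mp h3 (or_imp (ax (.orRight _ _)) (ax (.orLeft _ _)))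
    · exact or_inl (.premise hγ) _
  exact .mp h4 (or_imp (imp_refl _) (imp_refl _))

/-- Such an `a` lies below a co-atom `k`, so `k` is derivable, hence `k ∨ φ`, and the co-atom rule
gives `φ`. -/
theorem of_const {a : B} (ha : a ≠ 1) (h : Derives Γ (const a)) (φ : Fm B V) : Derives Γ φ := by
  rcases eq_top_or_exists_le_coatom a with h1 | ⟨k, hk, hak⟩
  · exact (ha (h1.trans one_eq_top.symm)).elim
  · have hb : Derives Γ (Fm.iff (const (MTLChain.imp a k)) (imp (const a) (const k))) :=
      ax (.bookImp a k)
    rw [imp_eq_one_iff.2 hak] at hb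
    exact .coatom hk (or_inl (.mp h (.mp (ax .truth) hb.iff_mp)) _)

theorem exists_mem_chain {c : Set (Set (Fm B V))} (hc : IsChain (· ⊆ ·) c) (hne : c.Nonempty)
    (h : Derives (⋃₀ c) φ) : ∃ S ∈ c, Derives S φ := by
  induction h with
  | thm h => exact hne.imp fun S hS => ⟨hS, .thm h⟩
  | premise h =>
    obtain ⟨S, hS, hφ⟩ := h
    exact ⟨S, hS, .premise hφ⟩
  | mp _ _ ih ih' =>
    obtain ⟨S, hS, h1⟩ := ih
    obtain ⟨S', hS', h2⟩ := ih'
    rcases hc.total hS hS' with hle | hle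
    · exact ⟨S', hS', .mp (h1.mono hle) h2⟩
    · exact ⟨S, hS, .mp h1 (h2.mono hle)⟩
  | coatom hk _ ih =>
    obtain ⟨S, hS, h1⟩ := ih
    exact ⟨S, hS, .coatom hk h1⟩

end Derives

end Calculus

/-! ### Canonical worlds -/

section Completeness

/-- The worlds of the canonical model: valuations that verify every theorem. -/
structure World (B : Type*) (V : Type*) [MTLChain B] [Fintype B] where
  val : Fm B V → B
  isValuation : IsValuation val
  isTheorem : ∀ {φ}, IsTheorem φ → val φ = 1

variable {B : Type*} {V : Type*} [MTLChain B] [Fintype B]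

theorem exists_maximal_not_derives {Γ : Set (Fm B V)} {φ : Fm B V} (h : ¬ Derives Γ φ) :
    ∃ T, Γ ⊆ T ∧ ¬ Derives T φ ∧ ∀ ψ, ¬ Derives (insert ψ T) φ → ψ ∈ T := by
  obtain ⟨T, hT, hmax⟩ := zorn_subset_nonempty {S : Set (Fm B V) | ¬ Derives S φ}
    (fun c hc hchain hne => ⟨⋃₀ c, fun hd => by
      obtain ⟨S, hS, hd⟩ := hd.exists_mem_chain hchain hne
      exact hc hS hd, fun S hS => Set.subset_sUnion_of_mem hS⟩) Γ h
  exact ⟨T, hT, hmax.prop, fun ψ hψ =>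
    hmax.le_of_ge hψ (Set.subset_insert ψ T) (Set.mem_insert ψ T)⟩

/-- Strong completeness of the propositional part, with boxed formulas treated as atoms. -/
theorem exists_world_of_not_derives {Γ : Set (Fm B V)} {φ : Fm B V} (h : ¬ Derives Γ φ) :
    ∃ g : World B V, (∀ γ ∈ Γ, g.val γ = 1) ∧ g.val φ ≠ 1 := by
  obtain ⟨T, hΓ, hT, hmax⟩ := exists_maximal_not_derives h
  -- If neither disjunct were derivable, maximality would let each of them, added to `T`, derive
  -- `φ`.
  have prime : ∀ {ψ χ}, Derives T (or ψ χ) → Derives T ψ ∨ Derives T χ := by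
    intro ψ χ hor
    by_contra! hcon
    refine hT (hor.or_elim ?_ ?_) <;> by_contra hd
    exacts [hcon.1 (.premise (hmax _ hd)), hcon.2 (.premise (hmax _ hd))]
  have consistent : ∀ {a : B}, Derives T (const a) → a = 1 := by
    intro a ha
    by_contra hne
    exact hT (ha.of_const hne φ)
  have exists_value : ∀ ψ, ∃ a : B, Derives T (Fm.iff ψ (const a)) := by
    intro ψ
    have key : ∀ l : List B,
        Derives T (l.foldr (fun a χ => or (Fm.iff ψ (const a)) χ) (const ⊥)) →
        ∃ a : B, Derives T (Fm.iff ψ (const a)) := by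
      intro l hl
      induction l with
      | nil => exact (hT (.mp hl (.ax (.exFalso _)))).elim
      | cons a l ih => exact (prime hl).elim (fun h => ⟨a, h⟩) ih
    exact key _ (.ax (.witness ψ))
  choose v hv using exists_value
  have le_of_imp : ∀ {a b : B}, Derives T (imp (const a) (const b)) → a ≤ b := fun hab =>
    imp_eq_one_iff.1 (consistent (.mp hab (Derives.ax (.bookImp _ _)).iff_mpr))
  have unique : ∀ {ψ a}, Derives T (Fm.iff ψ (const a)) → v ψ = a := by
    intro ψ a ha
    have := (hv ψ).iff_symm.iff_trans ha
    exact le_antisymm (le_of_imp this.iff_mp) (le_of_imp this.iff_mpr)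
  have val_one : ∀ {ψ}, Derives T ψ ↔ v ψ = 1 := by
    intro ψ
    constructor
    · exact fun hd => unique (.iff_intro ((Derives.ax .truth).imp_const _) (hd.imp_const _))
    · intro h1
      have := (hv ψ).iff_mpr
      rw [h1] at this
      exact .mp (.ax .truth) this
  refine ⟨⟨v, ⟨?_, ?_, ?_, ?_, ?_⟩, fun hth => val_one.1 (.thm hth)⟩,
    fun γ hγ => val_one.1 (.premise (hΓ hγ)), fun h1 => hT (val_one.2 h1)⟩
  · exact fun a => unique (.iff_intro (.imp_refl _) (.imp_refl _))
  · exact fun ψ χ => unique (.iff_trans (.iff_intro (.and_mono (hv ψ).iff_mp (hv χ).iff_mp)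
      (.and_mono (hv ψ).iff_mpr (hv χ).iff_mpr)) (Derives.ax (.bookAnd _ _)).iff_symm)
  · exact fun ψ χ => unique (.iff_trans (.iff_intro (.or_mono (hv ψ).iff_mp (hv χ).iff_mp)
      (.or_mono (hv ψ).iff_mpr (hv χ).iff_mpr)) (Derives.ax (.bookOr _ _)).iff_symm)
  · exact fun ψ χ => unique (.iff_trans (.iff_intro (.prod_mono (hv ψ).iff_mp (hv χ).iff_mp)
      (.prod_mono (hv ψ).iff_mpr (hv χ).iff_mpr)) (Derives.ax (.bookProd _ _)).iff_symm)
  · exact fun ψ χ => unique (.iff_trans (.iff_intro (.imp_mono (hv ψ).iff_mpr (hv χ).iff_mp)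
      (.imp_mono (hv ψ).iff_mp (hv χ).iff_mpr)) (Derives.ax (.bookImp _ _)).iff_symm)

/-- Allows theorems under a box to be checked by computing in `B` instead of deriving them. -/
theorem IsTheorem.of_forall_world {φ : Fm B V} (h : ∀ g : World B V, g.val φ = 1) :
    IsTheorem φ := by
  by_contra hφ
  obtain ⟨g, -, hg⟩ := exists_world_of_not_derives (fun hd : Derives ∅ φ => hφ hd.isTheorem)
  exact hg (h g)

/-! ### Canonical accessibility relations -/

namespace World

variable {g g' g'' : World B V} {a b : B} {φ ψ : Fm B V}

theorem le_of_isTheorem (g : World B V) (h : IsTheorem (imp φ ψ)) : g.val φ ≤ g.val ψ :=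
  g.isValuation.imp_eq_one.1 (g.isTheorem h)

theorem le_of_modalAxiom (g : World B V) (h : ModalAxiom (imp φ ψ)) : g.val φ ≤ g.val ψ :=
  g.le_of_isTheorem (.modalAxiom h)

theorem box_mono (g : World B V) (b : B) (h : ∀ g' : World B V, g'.val φ ≤ g'.val ψ) :
    g.val (box b φ) ≤ g.val (box b ψ) :=
  g.le_of_isTheorem (.mon b (.of_forall_world fun g' => g'.isValuation.imp_eq_one.2 (h g')))

theorem box_of_box_coatom_or {k : B} (hk : IsCoatom k)
    (h : g.val (box b (or (const k) φ)) = 1) : g.val (box b φ) = 1 := by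
  have h1 := g.le_of_modalAxiom (.crisp b k hk φ)
  rwa [h, one_le_iff, g.isValuation.or, g.isValuation.const, max_coatom_eq_one_iff hk] at h1

/-- K is not an axiom, but `φ ∧ (φ → ψ)` implies `k ∨ ψ`: either `φ` has value 1 and `φ → ψ` equals
`ψ`, or `φ` is at most `k`. The axiom `crisp` then removes `k`. -/
theorem box_mp (h : g.val (box b φ) = 1) (h' : g.val (box b (imp φ ψ)) = 1) :
    g.val (box b ψ) = 1 := by
  rcases eq_top_or_exists_le_coatom (g.val (box b ψ)) with h1 | ⟨k, hk, -⟩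
  · exact h1.trans one_eq_top.symm
  · refine box_of_box_coatom_or hk (one_le_iff.1 ?_)
    calc (1 : B) = g.val (and (box b φ) (box b (imp φ ψ))) := by
          rw [g.isValuation.and, h, h', min_self]
      _ ≤ g.val (box b (and φ (imp φ ψ))) := g.le_of_modalAxiom (.boxAnd b _ _)
      _ ≤ g.val (box b (or (const k) ψ)) := g.box_mono b fun g' => by
          have hv := g'.isValuation
          rw [hv.or, hv.const, hv.and, hv.imp]
          by_cases hφ : g'.val φ = 1
          · rw [hφ, one_imp]
            exact (min_le_right _ _).trans (le_max_right _ _)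
          · exact (min_le_left _ _).trans ((le_coatom hk hφ).trans (le_max_left _ _))

theorem box_of_derives (h : Derives {ψ | g.val (box b ψ) = 1} φ) : g.val (box b φ) = 1 := by
  induction h with
  | thm h => exact g.isTheorem (.nec b h)
  | premise h => exact h
  | mp _ _ ih ih' => exact box_mp ih ih'
  | coatom hk _ ih => exact box_of_box_coatom_or hk ih

theorem val_box_const_imp (g : World B V) (a b : B) (φ : Fm B V) :
    g.val (box b (imp (const a) φ)) = MTLChain.imp a (g.val (box b φ)) := by
  have h := g.isValuation.iff_eq_one.1 (g.isTheorem (.modalAxiom (.boxConst b a φ)))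
  rwa [g.isValuation.imp, g.isValuation.const] at h

/-- The canonical accessibility relation of `□_b`. -/
def Acc (b : B) (g g' : World B V) : Prop := ∀ φ, g.val (box b φ) ≤ g'.val φ

theorem acc_of_forall_eq_one (h : ∀ φ, g.val (box b φ) = 1 → g'.val φ = 1) : Acc b g g' := by
  intro φ
  -- Constants move through the box, so boxing this formula gives `a → a` with `a` the value of `□_b
  -- φ`.
  have h1 := h (imp (const (g.val (box b φ))) φ)
    (by rw [val_box_const_imp, imp_eq_one_iff])
  rwa [g'.isValuation.imp_eq_one, g'.isValuation.const] at h1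

/-- Moving `c` inside the box reduces the claim to `□_b (c → φ)` having value 1. Otherwise `c → φ`
is not derivable from the formulas boxed at value 1, and a world refuting it is a successor with `φ`
not above `c`. -/
theorem le_val_box {c : B} : c ≤ g.val (box b φ) ↔ ∀ g', Acc b g g' → c ≤ g'.val φ := by
  refine ⟨fun h g' hg => h.trans (hg φ), fun h => ?_⟩
  rw [← imp_eq_one_iff, ← val_box_const_imp]
  refine box_of_derives ?_
  by_contra hd
  obtain ⟨g', hg', hne⟩ := exists_world_of_not_derives hd
  refine hne (g'.isValuation.imp_eq_one.2 ?_)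
  rw [g'.isValuation.const]
  exact h g' (acc_of_forall_eq_one hg')

theorem Acc.refl (b : B) (g : World B V) : Acc b g g :=
  fun φ => g.le_of_modalAxiom (.reflexive b φ)

theorem Acc.trans (h : Acc a g g') (h' : Acc b g' g'') : Acc (min a b) g g'' :=
  fun φ => (g.le_of_modalAxiom (.transitive a b φ)).trans ((h _).trans (h' φ))

theorem Acc.anti (hab : a ≤ b) (h : Acc b g g') : Acc a g g' :=
  fun φ => (g.le_of_modalAxiom (.nested a b hab φ)).trans (h φ)

theorem Acc.symm (h : Acc ⊥ g g') : Acc ⊥ g' g := by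
  intro φ
  set a := g.val φ with ha
  -- Apply `B_0` to `φ → a`, which has value 1 at `g`. The conjunct of the diamond indexed by `a`
  -- then bounds `□_⊥ ((φ → a) → a)` at `g'` by `a`, and `φ` implies `(φ → a) → a`.
  have h1 : (1 : B) ≤ g'.val (dia ⊥ (imp φ (const a))) :=
    calc (1 : B) = g.val (imp φ (const a)) := by
          rw [eq_comm, g.isValuation.imp_eq_one, g.isValuation.const]
      _ ≤ g.val (box ⊥ (dia ⊥ (imp φ (const a)))) := g.le_of_modalAxiom (.symmetric _)
      _ ≤ _ := h _
  have h2 := g'.isValuation.le_bigAnd.1 h1 a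
  rw [one_le_iff, g'.isValuation.imp_eq_one, g'.isValuation.const] at h2
  refine (g'.box_mono ⊥ fun f => ?_).trans h2
  have hv := f.isValuation
  rw [hv.imp, hv.imp, hv.const, le_imp_iff, mul_comm]
  exact imp_mul_le _ _

end World

end Completeness

/-! ### The canonical preference model -/

section CanonicalModel

variable {B : Type u} {V : Type v} [MTLChain B] [Fintype B]

open Classical in
/-- The largest `b` for which the accessibility relation of `□_b` holds. -/
noncomputable def World.degree (g g' : World B V) : B :=
  (Finset.univ.filter fun b => World.Acc b g g').sup id

/-- In a finite chain the supremum of a nonempty set is attained, and `Acc` is antitone. The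
hypothesis supplies nonemptiness: the empty supremum `⊥` would wrongly suggest `Acc ⊥`. -/
theorem World.le_degree_iff {g g' : World B V} (h : World.Acc ⊥ g g') {b : B} :
    b ≤ g.degree g' ↔ World.Acc b g g' := by
  classical
  constructor
  · intro hb
    obtain ⟨c, hc, heq⟩ := Finset.exists_mem_eq_sup
      (Finset.univ.filter fun b => World.Acc b g g') ⟨⊥, by simpa using h⟩ id
    have hc' : World.Acc c g g' := by simpa using hc
    rw [World.degree] at hb
    exact hc'.anti (hb.trans heq.le)
  · intro hb
    rw [World.degree]
    exact Finset.le_sup (f := id) (by simpa using hb)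

theorem World.acc_bot_of_common {g x y : World B V} (hx : World.Acc ⊥ g x)
    (hy : World.Acc ⊥ g y) : World.Acc ⊥ x y := by
  simpa using hx.symm.trans hy

/-- The component of the canonical model around the world `g`. -/
noncomputable def canonicalModel (g : World B V) : PrefModel.{u, v, max u v w} B V where
  -- Since `⊥ ≤ P x y` always holds, `□_⊥` ranges over all worlds of the model, so these must form
  -- one `Acc ⊥`-class. The lift only adjusts the universe.
  W := ULift.{w} {g' : World B V // World.Acc ⊥ g g'}
  P x y := x.down.1.degree y.down.1
  e x p := x.down.1.val (var p)
  refl x := one_le_iff.1 ((World.le_degree_iff (.refl _ _)).2 (.refl _ _))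
  trans x y z := by
    have hacc : ∀ x y : ULift.{w} {g' : World B V // World.Acc ⊥ g g'},
        World.Acc ⊥ x.down.1 y.down.1 :=
      fun x y => World.acc_bot_of_common x.down.2 y.down.2
    exact (World.le_degree_iff (hacc x z)).2
      (((World.le_degree_iff (hacc x y)).1 le_rfl).trans
        ((World.le_degree_iff (hacc y z)).1 le_rfl))

theorem le_canonicalModel_P {g : World B V} {b : B} {x y : (canonicalModel.{u, v, w} g).W} :
    b ≤ (canonicalModel.{u, v, w} g).P x y ↔ World.Acc b x.down.1 y.down.1 :=
  World.le_degree_iff (World.acc_bot_of_common x.down.2 y.down.2)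

theorem canonicalModel_eval (g : World B V) (φ : Fm B V) :
    ∀ x : (canonicalModel.{u, v, w} g).W,
      (canonicalModel.{u, v, w} g).eval φ x = x.down.1.val φ := by
  induction φ with
  | var p => intro x; rw [PrefModel.eval]; rfl
  | const a => intro x; rw [PrefModel.eval, x.down.1.isValuation.const]
  | and φ ψ ih ih' => intro x; rw [PrefModel.eval, x.down.1.isValuation.and, ih, ih']
  | or φ ψ ih ih' => intro x; rw [PrefModel.eval, x.down.1.isValuation.or, ih, ih']
  | prod φ ψ ih ih' => intro x; rw [PrefModel.eval, x.down.1.isValuation.prod, ih, ih']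
  | imp φ ψ ih ih' => intro x; rw [PrefModel.eval, x.down.1.isValuation.imp, ih, ih']
  | box b φ ih =>
    intro x
    refine eq_of_forall_le_iff fun c => ?_
    rw [PrefModel.le_eval_box, World.le_val_box]
    constructor
    · intro h g' hg'
      -- No successor is lost by restricting to the class: `min ⊥ b = ⊥`.
      have hmem : World.Acc ⊥ g g' := by simpa using x.down.2.trans hg'
      exact (h ⟨⟨g', hmem⟩⟩ (le_canonicalModel_P.2 hg')).trans (ih ⟨⟨g', hmem⟩⟩).le
    · intro h y hy
      rw [ih]
      exact h _ (le_canonicalModel_P.1 hy)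

end CanonicalModel

end FuzzyPref

open FuzzyPref in
theorem mainTheorem2 {B : Type u} [MTLChain B] [Fintype B] {V : Type v}
    (Γ : Set (FuzzyPref.Fm B V)) (φ : FuzzyPref.Fm B V) :
    FuzzyPref.Derives Γ φ ↔ FuzzyPref.PrefEntails.{u, v, max u v w} Γ φ := by
  refine ⟨fun h M => h.sound, fun h => ?_⟩
  by_contra hd
  obtain ⟨g, hΓ, hφ⟩ := exists_world_of_not_derives hd
  let x : (canonicalModel.{u, v, w} g).W := ⟨⟨g, World.Acc.refl ⊥ g⟩⟩
  exact hφ ((canonicalModel_eval g φ x).symm.trans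
    (h (canonicalModel g) x fun γ hγ => (canonicalModel_eval g γ x).trans (hΓ γ hγ)))
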